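/- Let $G$ be a finite abelian group, let $n\ge 1$, and let $\gamma: G\hookrightarrow \mathrm{SL}_n(\mathbb{C})$ be a faithful representation that has no summand isomorphic to the trivial representation $\mathbf 1_G$. Let $\chi_0=\mathbf 1_G,\chi_1,\dots,\chi_\ell$ be the irreducible complex characters of $G$, let $\chi_\gamma$ be the character of $\gamma$, and define $m_{ij}$ by $\chi_\gamma\cdot\chi_i=\sum_{j=0}^{\ell} m_{ij}\chi_j$. Let $C=(n\delta_{ij}-m_{ij})_{1\le i,j\le \ell}$ be the McKay--Cartan matrix of $\gamma$, let $K(\gamma)=\mathbb{Z}^\ell/\mathrm{im}(C^t)$ be the critical group of $\gamma$, and let $\widehat G=\mathrm{Hom}(G,\mathbb{C}^\times)$. Then the following are equivalent: 1. $K(\gamma)\cong\widehat G$ as abelian groups; 2. $n=2$; 3. $\gamma$ is of McKay's type $\mathsf{A}_{m-1}$ for some $m\ge 2$: $G\cong\mathbb{Z}/m\mathbb{Z}$, and for a suitable generator $g$ of $G$ and a suitable basis of the representation space (which is two-dimensional), $\gamma(g)$ is given by the matrix $\begin{pmatrix}\omega_m&0\\0&\omega_m^{-1}\end{pmatrix}$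 with $\omega_m=e^{2\pi i/m}$. -/

import Mathlib

open scoped MatrixGroups

noncomputable section

namespace McKay

/-- The cokernel of the transpose, `coker (Cᵗ : ℤ^ι → ℤ^ι) = ℤ^ι / im Cᵗ`. -/
abbrev cokerTranspose {ι : Type*} [Fintype ι] (C : Matrix ι ι ℤ) : Type _ :=
  (ι → ℤ) ⧸ LinearMap.range C.transpose.mulVecLin

/-- `χ` is the character of an irreducible (finite-dimensional, complex) representation of `G`. -/
def IsIrreducibleCharacter {G : Type*} [Group G] (χ : G → ℂ) : Prop :=
  ∃ (d : ℕ) (ρ : Representation ℂ G (Fin d → ℂ)), ρ.IsIrreducible ∧ ρ.character = χ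

/-- The set of irreducible complex characters of `G`. -/
abbrev IrrChar (G : Type*) [Group G] : Type _ :=
  {χ : G → ℂ // IsIrreducibleCharacter χ}

namespace IrrChar

variable {G : Type*} [Group G]

/-- The degree of an irreducible character. -/
def degree (χ : IrrChar G) : ℕ := χ.2.choose

/-- An irreducible representation affording the irreducible character `χ`
(it is unique up to isomorphism when `G` is finite). -/
def rep (χ : IrrChar G) : Representation ℂ G (Fin χ.degree → ℂ) := χ.2.choose_spec.choose

theorem rep_isIrreducible (χ : IrrChar G) : χ.rep.IsIrreducible :=
  χ.2.choose_spec.choose_spec.1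

theorem rep_character (χ : IrrChar G) : χ.rep.character = χ.1 :=
  χ.2.choose_spec.choose_spec.2

/-- A finite group has finitely many irreducible characters, by orthogonality. -/
instance [Finite G] : Finite (IrrChar G) := by
  classical
  have := Fintype.ofFinite G
  have hG : (Nat.card G : ℂ) ≠ 0 := Nat.cast_ne_zero.mpr Nat.card_pos.ne'
  have : Invertible (Nat.card G : ℂ) := invertibleOfNonzero hG
  have orth (χ ψ : IrrChar G) :
      (Nat.card G : ℂ)⁻¹ * ∑ g : G, χ.1 g * ψ.1 g⁻¹ = if χ = ψ then 1 else 0 := by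
    have := χ.rep_isIrreducible
    have := ψ.rep_isIrreducible
    rcases eq_or_ne χ ψ with rfl | h
    · have key := Representation.char_orthonormal χ.rep χ.rep
      rw [if_pos ⟨Representation.Equiv.refl _⟩, rep_character] at key
      simpa using key
    · have key := Representation.char_orthonormal χ.rep ψ.rep
      have hne : ¬ Nonempty (Representation.Equiv ψ.rep χ.rep) := by
        rintro ⟨e⟩
        have := Representation.char_iso e
        rw [rep_character, rep_character] at this
        exact h (Subtype.ext this.symm)
      rw [if_neg hne, rep_character, rep_character] at key
      simpa [h] using key
  have li : LinearIndependent ℂ (fun χ : IrrChar G => χ.1) := by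
    rw [linearIndependent_iff']
    intro s c hc ψ hψ
    have h1 : (Nat.card G : ℂ)⁻¹ * ∑ g : G, (∑ χ ∈ s, c χ • χ.1) g * ψ.1 g⁻¹ = c ψ := by
      calc _ = ∑ χ ∈ s, c χ * ((Nat.card G : ℂ)⁻¹ * ∑ g : G, χ.1 g * ψ.1 g⁻¹) := by
            simp only [Finset.sum_apply, Pi.smul_apply, smul_eq_mul, Finset.sum_mul,
              Finset.mul_sum]
            rw [Finset.sum_comm]
            refine Finset.sum_congr rfl fun χ _ => Finset.sum_congr rfl fun g _ => by ring
        _ = c ψ := by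
            simp_rw [orth]
            simp [hψ]
    rw [hc] at h1
    simpa using h1.symm
  exact li.finite

instance [Finite G] : Fintype (IrrChar G) := Fintype.ofFinite _

open Classical in
instance : DecidableEq (IrrChar G) := inferInstance

end IrrChar

section Matrices

variable {G V : Type*} [Group G] [AddCommGroup V] [Module ℂ V]

/-- The matrix `M = (m_{χψ})`, where `m_{χψ}` is the multiplicity of `ψ` in `γ ⊗ χ`, that is, the
dimension of the space of `G`-maps from `ψ` to `γ ⊗ χ`; so `χ_γ · χ = ∑ ψ, m_{χψ} ψ`. -/
def mckayMatrix (γ : Representation ℂ G V) : Matrix (IrrChar G) (IrrChar G) ℤ :=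
  Matrix.of fun χ ψ =>
    (Module.finrank ℂ (Representation.IntertwiningMap ψ.rep (γ.tprod χ.rep)) : ℤ)

/-- The extended McKay-Cartan matrix `n I - M`, where `n = dim γ`. -/
def extendedMcKayCartan (γ : Representation ℂ G V) : Matrix (IrrChar G) (IrrChar G) ℤ :=
  (Module.finrank ℂ V : ℤ) • (1 : Matrix (IrrChar G) (IrrChar G) ℤ) - mckayMatrix γ

/-- The irreducible characters other than the trivial one (the constant function `1`). -/
abbrev NontrivialIrrChar (G : Type*) [Group G] : Type _ :=
  {χ : IrrChar G // χ.1 ≠ 1}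

instance [Finite G] : Fintype (NontrivialIrrChar G) := Fintype.ofFinite _

/-- The McKay-Cartan matrix: remove the row and the column of the trivial character. -/
def mckayCartan (γ : Representation ℂ G V) :
    Matrix (NontrivialIrrChar G) (NontrivialIrrChar G) ℤ :=
  (extendedMcKayCartan γ).submatrix (fun χ => χ.1) (fun χ => χ.1)

/-- The critical group `K(γ) = coker Cᵗ` of a representation of a finite group, with `C` its
McKay-Cartan matrix. -/
abbrev criticalGroup [Finite G] (γ : Representation ℂ G V) : Type _ :=
  cokerTranspose (mckayCartan γ)

end Matrices

section Linear

variable {G : Type*} [Group G] {n : ℕ}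

/-- The representation on `ℂⁿ` given by a homomorphism to `SL_n(ℂ)`. -/
def slRep (γ : G →* SL(n, ℂ)) : Representation ℂ G (Fin n → ℂ) where
  toFun g := Matrix.toLin' (γ g : Matrix (Fin n) (Fin n) ℂ)
  map_one' := by simp; rfl
  map_mul' g h := by simp [Matrix.toLin'_mul]; rfl

/-- `γ` is, up to isomorphism of representations, the classical two-dimensional McKay
representation of type `A_{m-1}` for some `m ≥ 2`: `G` is identified with `ℤ/mℤ`, and in some
basis the generator acts by the matrix `diag(ω, ω⁻¹)` with `ω = exp(2πi/m)`. -/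
def IsMcKayTypeA (γ : G →* SL(n, ℂ)) : Prop :=
  ∃ (m : ℕ) (φ : Multiplicative (ZMod m) ≃* G) (b : Module.Basis (Fin 2) ℂ (Fin n → ℂ)),
    2 ≤ m ∧
    LinearMap.toMatrix b b (slRep γ (φ (Multiplicative.ofAdd 1))) =
      !![Complex.exp (2 * Real.pi * Complex.I / m), 0;
         0, (Complex.exp (2 * Real.pi * Complex.I / m))⁻¹]

end Linear

end McKay

end

/-! Diagonalize `γ` as a sum of linear characters `χ i`: none is trivial, together they separate
points of `G`, and their product is `1` because the determinant is `1`. Tensoring with `γ` then acts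
on `ℤ[Ĝ]` as multiplication by `∑ i, χ i`, so `Cᵗ` is multiplication by `σ = ∑ i, (1 - χ i)` with
the coordinate of the identity deleted. Since `∏ i, χ i = 1`, the map `f ↦ ∏ x, x ^ f x` (`powProd`)
induces a surjection from `K(γ)` onto the finite group `Ĝ`; an abstract isomorphism exists exactly
when this surjection is injective.

If `n = 2`, then `σ = (1 - u) + (1 - u⁻¹)` with `u` faithful, hence a generator of `Ĝ`. The
relations form a linear recurrence along powers of `u`, which makes the cokernel cyclic of order
dividing that of `u`.

Conversely, injectivity makes `σ` divide every `(1 - b) (1 - b')` in `ℤ[Ĝ]`. Evaluating at `g` gives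
algebraic integers `(1 - χ i g)² / σ(g)`, and comparing sizes over all embeddings shows that at most
two `χ i g` differ from `1` (`card_filter_ne_one_le_two`). Integrality of Fourier coefficients then
rules out `n > 2` (`card_le_two_of_injective`), and `n = 1` would force a trivial character. -/

namespace McKay

/-! ### Linear characters, multiplicities and diagonalization -/

section Characters

variable {G : Type*} [CommGroup G]

theorem IsIrreducibleCharacter.exists_monoidHom {χ : G → ℂ} (hχ : IsIrreducibleCharacter χ) :
    ∃ φ : G →* ℂˣ, ∀ g, χ g = φ g := by
  obtain ⟨d, ρ, hρ, rfl⟩ := hχ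
  have hd := Representation.IsIrreducible.finrank_eq_one_of_isMulCommutative ρ
  rw [Module.finrank_fin_fun] at hd
  subst hd
  -- In dimension one the trace equals the determinant, which is multiplicative.
  refine ⟨(LinearMap.det.comp ρ).toHomUnits, fun g => ?_⟩
  rw [MonoidHom.coe_toHomUnits, MonoidHom.comp_apply, ← LinearMap.det_toMatrix',
    Matrix.det_fin_one, Representation.character, LinearMap.trace_eq_matrix_trace ℂ
    (Pi.basisFun ℂ (Fin 1)),
    Matrix.trace_fin_one]
  rfl

theorem isIrreducibleCharacter_monoidHom (φ : G →* ℂˣ) :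
    IsIrreducibleCharacter fun g => (φ g : ℂ) := by
  let ρ : Representation ℂ G (Fin 1 → ℂ) :=
    { toFun g := (φ g : ℂ) • LinearMap.id
      map_one' := by simp; rfl
      map_mul' g h := by ext; simp [mul_assoc, mul_left_comm] }
  refine ⟨1, ρ, ?_, ?_⟩
  · have hs : IsSimpleOrder (Submodule ℂ (Fin 1 → ℂ)) :=
      (isSimpleModule_iff ..).1 (isSimpleModule_iff_finrank_eq_one.2 (by simp))
    have : Nontrivial (Subrepresentation ρ) := by
      refine ⟨⊥, ⊤, fun h => ?_⟩
      have := congrArg Subrepresentation.toSubmodule h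
      exact bot_ne_top this
    refine ⟨fun W => ?_⟩
    rcases hs.eq_bot_or_eq_top W.toSubmodule with h | h
    · left; exact Subrepresentation.toSubmodule_injective h
    · right; exact Subrepresentation.toSubmodule_injective h
  · ext g
    simp [Representation.character, ρ]

/-- The irreducible characters of an abelian group are its linear characters. -/
noncomputable def linearCharEquiv : (G →* ℂˣ) ≃ IrrChar G :=
  Equiv.ofBijective (fun φ => ⟨fun g => φ g, isIrreducibleCharacter_monoidHom φ⟩) (by
    constructor
    · intro φ ψ h
      ext g
      exact congrFun (congrArg Subtype.val h) g
    · rintro ⟨χ, hχ⟩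
      obtain ⟨φ, hφ⟩ := hχ.exists_monoidHom
      exact ⟨φ, Subtype.ext (funext fun g => (hφ g).symm)⟩)

theorem linearCharEquiv_apply (φ : G →* ℂˣ) (g : G) : (linearCharEquiv φ).1 g = φ g := rfl

theorem linearCharEquiv_eq_one_iff (φ : G →* ℂˣ) : (linearCharEquiv φ).1 = 1 ↔ φ = 1 := by
  constructor
  · intro h
    ext g
    exact congrFun h g
  · rintro rfl
    ext g
    simp [linearCharEquiv_apply]

/-- The nontrivial irreducible characters of an abelian group are its nontrivial linear
characters. -/
noncomputable def nontrivialLinearCharEquiv : {φ : G →* ℂˣ // φ ≠ 1} ≃ NontrivialIrrChar G :=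
  linearCharEquiv.subtypeEquiv fun φ => not_congr (linearCharEquiv_eq_one_iff φ).symm

theorem sum_monoidHom_units [Fintype G] [DecidableEq (G →* ℂˣ)] (φ : G →* ℂˣ) :
    ∑ g, (φ g : ℂ) = if φ = 1 then (Nat.card G : ℂ) else 0 := by
  have := sum_hom_units ((Units.coeHom ℂ).comp φ)
  simp only [MonoidHom.comp_apply, Units.coeHom_apply] at this
  rw [this, ← Nat.card_eq_fintype_card]
  have : (Units.coeHom ℂ).comp φ = 1 ↔ φ = 1 := by
    simp [MonoidHom.ext_iff]
  simp only [this]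
  split_ifs <;> simp

variable {V : Type*} [AddCommGroup V] [Module ℂ V] [Finite G]

theorem mckayMatrix_linearCharEquiv {ι : Type*} [Fintype ι] (γ : Representation ℂ G V)
    (b : Module.Basis ι ℂ V) (χ : ι → G →* ℂˣ) (hb : ∀ g i, γ g (b i) = (χ i g : ℂ) • b i)
    [DecidableEq (G →* ℂˣ)] (φ ψ : G →* ℂˣ) :
    mckayMatrix γ (linearCharEquiv φ) (linearCharEquiv ψ) =
      (Finset.univ.filter fun i => χ i * φ = ψ).card := by
  classical
  have := Fintype.ofFinite G
  have : FiniteDimensional ℂ V := b.finiteDimensional_of_finite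
  have hG : (Nat.card G : ℂ) ≠ 0 := Nat.cast_ne_zero.mpr Nat.card_pos.ne'
  have : Invertible (Nat.card G : ℂ) := invertibleOfNonzero hG
  have hγ (g : G) : γ.character g = ∑ i, (χ i g : ℂ) := by
    rw [Representation.character, LinearMap.trace_eq_matrix_trace ℂ b]
    simp [Matrix.trace, LinearMap.toMatrix_apply, hb]
  have key := Representation.card_inv_mul_sum_char_mul_char_eq_finrank
    (linearCharEquiv ψ).rep (γ.tprod (linearCharEquiv φ).rep)
  rw [mckayMatrix, Matrix.of_apply, Nat.cast_inj, ← @Nat.cast_inj ℂ, ← key]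
  simp only [Representation.char_tensor, IrrChar.rep_character, Pi.mul_apply,
    linearCharEquiv_apply, hγ, Finset.sum_mul]
  rw [Finset.sum_comm]
  have hs (i : ι) : ∑ g, (χ i g : ℂ) * φ g * ψ g⁻¹ =
      if χ i * φ = ψ then (Nat.card G : ℂ) else 0 := by
    have := sum_monoidHom_units (χ i * φ * ψ⁻¹)
    have h1 : χ i * φ * ψ⁻¹ = 1 ↔ χ i * φ = ψ := by
      rw [MonoidHom.ext_iff, MonoidHom.ext_iff]
      simp [mul_inv_eq_one]
    rw [← if_congr h1 rfl rfl, ← this]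
    simp
  simp only [hs, Finset.sum_ite, Finset.sum_const, nsmul_eq_mul, mul_zero, add_zero]
  field_simp

/-- A representation of a finite abelian group is diagonalizable. -/
theorem exists_eigenbasis [FiniteDimensional ℂ V] (γ : Representation ℂ G V) :
    ∃ (b : Module.Basis (Fin (Module.finrank ℂ V)) ℂ V) (χ : Fin (Module.finrank ℂ V) → G →* ℂˣ),
      ∀ g i, γ g (b i) = (χ i g : ℂ) • b i := by
  classical
  have := Fintype.ofFinite G
  have hG : (Nat.card G : ℂ) ≠ 0 := Nat.cast_ne_zero.mpr Nat.card_pos.ne'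
  let s : Set V := {v | ∃ φ : G →* ℂˣ, ∀ g, γ g v = (φ g : ℂ) • v}
  have hs : ⊤ ≤ Submodule.span ℂ s := by
    rintro v -
    -- Unnormalized projections onto the isotypic components; summed over `φ` they give `|G| • v`.
    have hmem (φ : G →* ℂˣ) : ∑ g, (φ g⁻¹ : ℂ) • γ g v ∈ Submodule.span ℂ s := by
      refine Submodule.subset_span ⟨φ, fun h => ?_⟩
      rw [map_sum, Finset.smul_sum]
      refine Fintype.sum_equiv (Equiv.mulLeft h) _ _ fun g => ?_
      rw [map_smul, Equiv.coe_mulLeft, map_mul, Module.End.mul_apply, smul_smul]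
      congr 1
      simp [mul_left_comm (φ h : ℂ)]
    have := Fintype.ofFinite (G →* ℂˣ)
    have hsum : ∑ φ : G →* ℂˣ, ∑ g, (φ g⁻¹ : ℂ) • γ g v = (Nat.card G : ℂ) • v := by
      rw [Finset.sum_comm]
      simp only [← Finset.sum_smul]
      -- Orthogonality on the dual group: evaluation at `g⁻¹` is a character of it, trivial only for
      -- `g = 1` since characters separate points.
      have hg (g : G) : ∑ φ : G →* ℂˣ, (φ g⁻¹ : ℂ) = if g = 1 then (Nat.card G : ℂ) else 0 := by
        have h1 : (MonoidHom.eval g⁻¹ : (G →* ℂˣ) →* ℂˣ) = 1 ↔ g = 1 := by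
          rw [← inv_eq_one, ← CommGroup.forall_apply_eq_apply_iff (G := G) (M := ℂ),
            MonoidHom.ext_iff]
          simp
        have h2 := sum_monoidHom_units (MonoidHom.eval g⁻¹ : (G →* ℂˣ) →* ℂˣ)
        rwa [if_congr h1 rfl rfl, CommGroup.card_monoidHom_of_hasEnoughRootsOfUnity] at h2
      simp only [hg, ite_smul, zero_smul, Finset.sum_ite_eq', Finset.mem_univ, if_true,
        map_one, Module.End.one_apply]
    have : v = (Nat.card G : ℂ)⁻¹ • (Nat.card G : ℂ) • v := by rw [inv_smul_smul₀ hG]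
    rw [this, ← hsum]
    exact Submodule.smul_mem _ _ (Submodule.sum_mem _ fun φ _ => hmem φ)
  let b := Module.Basis.ofSpan hs
  have hb (i) : b i ∈ s := Module.Basis.ofSpan_subset hs ⟨i, rfl⟩
  have : Finite ↑((linearIndepOn_empty ℂ id).extend (Set.empty_subset s)) :=
    Module.Finite.finite_basis b
  let e := Finite.equivFinOfCardEq (Module.finrank_eq_nat_card_basis b).symm
  choose χ hχ using hb
  exact ⟨b.reindex e, fun i => χ (e.symm i), fun g i => by simpa using hχ _ g⟩

end Characters

end McKay

/-! ### Cokernels and the group ring -/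

namespace McKay

/-- Relabelling the rows and the columns of a matrix does not change its cokernel. -/
theorem nonempty_cokerTranspose_submatrix_equiv {ι κ : Type*} [Fintype ι] [Fintype κ] (e : κ ≃ ι)
    (C : Matrix ι ι ℤ) : Nonempty (cokerTranspose (C.submatrix e e) ≃+ cokerTranspose C) := by
  let L : (κ → ℤ) ≃ₗ[ℤ] (ι → ℤ) := LinearEquiv.funCongrLeft ℤ ℤ e.symm
  refine ⟨(Submodule.Quotient.equiv _ _ L ?_).toAddEquiv⟩
  have h (f : κ → ℤ) : L ((C.submatrix e e).transpose.mulVecLin f) =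
      C.transpose.mulVecLin (L f) := by
    ext i
    simp only [L, LinearEquiv.funCongrLeft_apply, LinearMap.funLeft_apply, Matrix.mulVecLin_apply,
      Matrix.mulVec, dotProduct]
    exact Fintype.sum_equiv e _ _ fun j => by simp
  ext v
  constructor
  · rintro ⟨_, ⟨f, rfl⟩, rfl⟩
    exact ⟨L f, (h f).symm⟩
  · rintro ⟨f, rfl⟩
    refine ⟨_, ⟨L.symm f, rfl⟩, ?_⟩
    have := h (L.symm f)
    rwa [L.apply_symm_apply] at this

section ShiftCartan

theorem sum_translate_smul {A : Type*} [CommGroup A] [Fintype A] (f : A → ℤ) (a : A) :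
    ∑ x, f (a⁻¹ * x) • Additive.ofMul x =
      ∑ x, f x • Additive.ofMul x + (∑ x, f x) • Additive.ofMul a := by
  rw [Finset.sum_smul, ← Finset.sum_add_distrib]
  refine (Fintype.sum_equiv (Equiv.mulLeft a) _ _ fun x => ?_).symm
  simp [smul_add, add_comm]

variable {A ι : Type*} [CommGroup A] [DecidableEq A]

/-- Extension by zero to the whole group. -/
def extendZero {M : Type*} [Zero M] (f : {x : A // x ≠ 1} → M) (x : A) : M :=
  if h : x ≠ 1 then f ⟨x, h⟩ else 0

theorem extendZero_coe {M : Type*} [Zero M] (f : {x : A // x ≠ 1} → M) (x : {x : A // x ≠ 1}) :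
    extendZero f x = f x := dif_pos x.2

theorem extendZero_one {M : Type*} [Zero M] (f : {x : A // x ≠ 1} → M) :
    extendZero f 1 = 0 := dif_neg (not_not.2 rfl)

variable [Fintype A] [Fintype ι]

/-- The matrix, indexed by the nontrivial elements of `A`, of multiplication by
`∑ i, (1 - a i)` in the group ring of `A`. -/
def shiftCartan (a : ι → A) : Matrix {x : A // x ≠ 1} {x : A // x ≠ 1} ℤ :=
  Matrix.of fun x y =>
    (Fintype.card ι : ℤ) * (if x = y then 1 else 0) -
      (Finset.univ.filter fun i => a i * x = y.1).card

/-- The product `∏ x, x ^ f x`, as a linear map in `f`. -/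
def powProd (A : Type*) [CommGroup A] [Fintype A] [DecidableEq A] :
    ({x : A // x ≠ 1} → ℤ) →ₗ[ℤ] Additive A :=
  Fintype.linearCombination ℤ fun x => Additive.ofMul x.1

theorem powProd_single (x : {x : A // x ≠ 1}) :
    powProd A (Pi.single x 1) = Additive.ofMul x.1 := by
  rw [powProd, Fintype.linearCombination_apply_single, one_smul]

theorem powProd_surjective : Function.Surjective (powProd A) := by
  intro x
  by_cases hx : x.toMul = 1
  · exact ⟨0, by rw [map_zero]; exact hx.symm⟩
  · exact ⟨_, powProd_single ⟨x.toMul, hx⟩⟩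

theorem sum_ne_one {M : Type*} [AddCommMonoid M] (f : A → M) (hf : f 1 = 0) :
    ∑ x : {x : A // x ≠ 1}, f x = ∑ x, f x := by
  rw [← Finset.sum_subtype (Finset.univ.filter fun x : A => x ≠ 1) (by simp) f]
  refine Finset.sum_subset (Finset.subset_univ _) fun x _ hx => ?_
  have : x = 1 := by simpa using hx
  rw [this, hf]

theorem transpose_shiftCartan_mulVec (a : ι → A) (f : {x : A // x ≠ 1} → ℤ)
    (x : {x : A // x ≠ 1}) :
    ((shiftCartan a).transpose.mulVec f) x =
      ∑ i, (extendZero f x - extendZero f ((a i)⁻¹ * x)) := by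
  have h1 : ∑ y : {y : A // y ≠ 1}, (Fintype.card ι : ℤ) * (if y = x then 1 else 0) * f y =
      Fintype.card ι * extendZero f x := by
    simp [extendZero_coe]
  have h2 : ∑ y : {y : A // y ≠ 1}, ((Finset.univ.filter fun i => a i * y = x.1).card : ℤ) * f y =
      ∑ i, extendZero f ((a i)⁻¹ * x) := by
    have h3 (y : {y : A // y ≠ 1}) :
        ((Finset.univ.filter fun i => a i * y = x.1).card : ℤ) * f y =
        (fun z : A => ((Finset.univ.filter fun i => a i * z = x.1).card : ℤ) * extendZero f z) y := by
      simp [extendZero_coe]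
    rw [Finset.sum_congr rfl fun y _ => h3 y,
      sum_ne_one (fun z : A => ((Finset.univ.filter fun i => a i * z = x.1).card : ℤ) *
        extendZero f z) (by simp [extendZero_one])]
    simp only [Finset.card_filter, Nat.cast_sum, Finset.sum_mul]
    rw [Finset.sum_comm]
    refine Finset.sum_congr rfl fun i _ => ?_
    rw [Finset.sum_eq_single ((a i)⁻¹ * x.1)]
    · simp
    · intro y _ hy
      rw [if_neg fun h => hy (by rw [← h, inv_mul_cancel_left])]
      simp
    · simp
  simp only [Matrix.mulVec, dotProduct, Matrix.transpose_apply, shiftCartan, Matrix.of_apply,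
    sub_mul, Finset.sum_sub_distrib, h1, h2]
  simp

theorem powProd_eq_sum (f : {x : A // x ≠ 1} → ℤ) :
    powProd A f = ∑ x, extendZero f x • Additive.ofMul x := by
  rw [← sum_ne_one _ (by simp), powProd, Fintype.linearCombination_apply]
  simp [extendZero_coe]

/-- Translating `f` by `a i` multiplies its product by `(a i) ^ ∑ f`, so the total discrepancy is a
power of `∏ i, a i`. The deleted coordinate is harmless, as the identity contributes nothing to a
product. -/
theorem powProd_transpose_shiftCartan_mulVec (a : ι → A) (ha : ∏ i, a i = 1)
    (f : {x : A // x ≠ 1} → ℤ) : powProd A ((shiftCartan a).transpose.mulVec f) = 0 := by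
  let g := extendZero f
  have h (x : A) : extendZero ((shiftCartan a).transpose.mulVec f) x • Additive.ofMul x =
      ∑ i, (g x • Additive.ofMul x - g ((a i)⁻¹ * x) • Additive.ofMul x) := by
    by_cases hx : x = 1
    · simp [hx]
    · have := extendZero_coe ((shiftCartan a).transpose.mulVec f) ⟨x, hx⟩
      rw [transpose_shiftCartan_mulVec] at this
      simp only at this
      rw [this, Finset.sum_smul]
      simp only [sub_smul, g]
  rw [powProd_eq_sum, Finset.sum_congr rfl fun x _ => h x, Finset.sum_comm]
  simp only [Finset.sum_sub_distrib, sum_translate_smul, sub_add_cancel_left]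
  rw [Finset.sum_neg_distrib, ← Finset.smul_sum, ← ofMul_prod, ha, ofMul_one, smul_zero, neg_zero]

/-- The cokernel is isomorphic to the group if and only if the canonical surjection between them
is injective. -/
theorem nonempty_cokerTranspose_shiftCartan_equiv_iff (a : ι → A) (ha : ∏ i, a i = 1) :
    Nonempty (cokerTranspose (shiftCartan a) ≃+ Additive A) ↔
      ∀ f, powProd A f = 0 → ∃ c, (shiftCartan a).transpose.mulVec c = f := by
  let P := LinearMap.range (shiftCartan a).transpose.mulVecLin
  have hP : P ≤ LinearMap.ker (powProd A) := by
    rintro _ ⟨f, rfl⟩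
    exact powProd_transpose_shiftCartan_mulVec a ha f
  let L : cokerTranspose (shiftCartan a) →ₗ[ℤ] Additive A := P.liftQ (powProd A) hP
  have hL : Function.Surjective L := by
    intro x
    obtain ⟨f, hf⟩ := powProd_surjective x
    exact ⟨P.mkQ f, hf⟩
  constructor
  · rintro ⟨e⟩ f hf
    have hs : Function.Surjective (L ∘ e.symm) := hL.comp e.symm.surjective
    -- A surjective self-map of the finite set `Additive A` is injective.
    have hi : Function.Injective L := by
      have := (Finite.injective_iff_surjective.2 hs).comp e.injective
      simpa [Function.comp_def] using this
    have : P.mkQ f = 0 := hi (by rw [map_zero]; exact hf)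
    rw [Submodule.mkQ_apply, Submodule.Quotient.mk_eq_zero] at this
    obtain ⟨c, hc⟩ := this
    exact ⟨c, hc⟩
  · intro h
    refine ⟨(LinearEquiv.ofBijective L ⟨?_, hL⟩).toAddEquiv⟩
    rw [← LinearMap.ker_eq_bot, Submodule.ker_liftQ_eq_bot]
    intro f hf
    obtain ⟨c, hc⟩ := h f hf
    exact ⟨c, hc⟩

/-- If the canonical surjection is injective, then `∑ i, (1 - a i)` divides `(1 - b) (1 - b')` in
the group ring. -/
theorem exists_sum_mul_eq_of_injective (a : ι → A)
    (h : ∀ f, powProd A f = 0 → ∃ c, (shiftCartan a).transpose.mulVec c = f) (b b' : A) :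
    ∃ c : A → ℤ, ∀ {R : Type} [CommRing R] (e : A →* R),
      (∑ i, (1 - e (a i))) * ∑ x, (c x : R) * e x = (1 - e b) * (1 - e b') := by
  let y : A → ℤ := Pi.single 1 1 - Pi.single b 1 - Pi.single b' 1 + Pi.single (b * b') 1
  have hy {R : Type} [CommRing R] (e : A →* R) :
      ∑ x, (y x : R) * e x = (1 - e b) * (1 - e b') := by
    simp only [y, Pi.add_apply, Pi.sub_apply, Pi.single_apply, Int.cast_add, Int.cast_sub,
      Int.cast_ite, Int.cast_one, Int.cast_zero, add_mul, sub_mul, ite_mul, one_mul, zero_mul,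
      Finset.sum_add_distrib, Finset.sum_sub_distrib, Finset.sum_ite_eq', Finset.mem_univ, if_true,
      map_one, map_mul]
    ring
  -- The coefficients `y` of `(1 - b) (1 - b')` lie in the kernel: the product is `b⁻¹ b'⁻¹ (b b') =
  -- 1`.
  obtain ⟨c, hc⟩ := h (fun x => y x) (by
    rw [powProd, Fintype.linearCombination_apply]
    rw [sum_ne_one (fun x => y x • Additive.ofMul x) (by simp)]
    simp only [y, Pi.add_apply, Pi.sub_apply, Pi.single_apply, add_smul, sub_smul, ite_smul,
      one_smul, zero_smul, Finset.sum_add_distrib, Finset.sum_sub_distrib, Finset.sum_ite_eq',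
      Finset.mem_univ, if_true, ofMul_one, ofMul_mul]
    abel)
  let d := extendZero c
  have hd (x : A) (hx : x ≠ 1) : ∑ i, (d x - d ((a i)⁻¹ * x)) = y x := by
    have := congrFun hc ⟨x, hx⟩
    rwa [transpose_shiftCartan_mulVec] at this
  have hsum {R : Type} [CommRing R] (e : A →* R) :
      ∑ x, ((∑ i, (d x - d ((a i)⁻¹ * x)) : ℤ) : R) * e x =
        (∑ i, (1 - e (a i))) * ∑ x, (d x : R) * e x := by
    simp only [Int.cast_sum, Finset.sum_mul]
    rw [Finset.sum_comm]
    refine Finset.sum_congr rfl fun i _ => ?_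
    simp only [Int.cast_sub, sub_mul, Finset.sum_sub_distrib, one_mul]
    congr 1
    rw [Finset.mul_sum]
    refine (Fintype.sum_equiv (Equiv.mulLeft (a i)) _ _ fun x => ?_).symm
    simp only [Equiv.coe_mulLeft, inv_mul_cancel_left, map_mul]
    ring
  -- The matrix equation omits the coordinate at `1`; it is recovered because both sides have
  -- augmentation zero.
  have h1 : ∑ i, (d 1 - d ((a i)⁻¹ * 1)) = y 1 := by
    have h2 : ∑ x, ((∑ i, (d x - d ((a i)⁻¹ * x))) - y x) = 0 := by
      have h3 := hsum (1 : A →* ℤ)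
      have h4 := hy (1 : A →* ℤ)
      simp only [MonoidHom.one_apply, mul_one, Int.cast_id, sub_self, Finset.sum_const_zero,
        zero_mul] at h3 h4
      rw [Finset.sum_sub_distrib, h3, h4, sub_self]
    rw [Finset.sum_eq_single 1 (fun x _ hx => by rw [hd x hx, sub_self]) (by simp)] at h2
    exact sub_eq_zero.1 h2
  refine ⟨d, fun e => ?_⟩
  rw [← hsum e, ← hy e]
  refine Finset.sum_congr rfl fun x _ => ?_
  by_cases hx : x = 1
  · rw [hx, h1]
  · rw [hd x hx]

theorem transpose_shiftCartan_mulVec_indicator (a : ι → A) {x : A} (hx : x ≠ 1) :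
    (shiftCartan a).transpose.mulVec (fun z => if z.1 = x then 1 else 0) =
      ∑ i, ((fun z => if z.1 = x then 1 else 0) - fun z => if z.1 = a i * x then 1 else 0) := by
  have h (y : A) : extendZero (fun z : {z : A // z ≠ 1} => if z.1 = x then (1 : ℤ) else 0) y =
      if y = x then 1 else 0 := by
    unfold extendZero
    split_ifs with h1 h2 h2 <;> simp_all
  ext z
  rw [transpose_shiftCartan_mulVec, Finset.sum_apply]
  simp only [h, Pi.sub_apply, inv_mul_eq_iff_eq_mul]

/-- Modulo the image, the indicators `s x` satisfy `s (u x) = 2 s x - s (u⁻¹ x)` for `x ≠ 1`, with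
`s 1 = 0`. Hence `s (u ^ k) = k • s u`, and a vector is determined modulo the image by an exponent
modulo `orderOf u`, which is what `powProd` detects. -/
theorem exists_transpose_shiftCartan_mulVec_eq (u : A) (hu : ∀ x, x ∈ Submonoid.powers u)
    {f : {x : A // x ≠ 1} → ℤ} (hf : powProd A f = 0) :
    ∃ c, (shiftCartan ![u, u⁻¹]).transpose.mulVec c = f := by
  let C := shiftCartan ![u, u⁻¹]
  let q := (LinearMap.range C.transpose.mulVecLin).mkQ
  let s (x : A) : {x : A // x ≠ 1} → ℤ := fun z => if z.1 = x then 1 else 0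
  have hs1 : s 1 = 0 := by
    ext z
    exact if_neg z.2
  have hrel (x : A) (hx : x ≠ 1) : q (s (u * x)) = 2 • q (s x) - q (s (u⁻¹ * x)) := by
    have h1 : q (C.transpose.mulVecLin (s x)) = 0 := by
      rw [Submodule.mkQ_apply, Submodule.Quotient.mk_eq_zero]
      exact ⟨_, rfl⟩
    have h2 : C.transpose.mulVecLin (s x) = (s x - s (u * x)) + (s x - s (u⁻¹ * x)) := by
      have := transpose_shiftCartan_mulVec_indicator ![u, u⁻¹] hx
      rw [Fin.sum_univ_two] at this
      exact this
    rw [h2, map_add, map_sub, map_sub] at h1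
    rw [two_smul, ← sub_eq_zero, ← neg_eq_zero, ← h1]
    abel
  -- The recurrence has order two, so consecutive values are carried together. The bound includes `k
  -- + 1 = orderOf u`, where `s 1 = 0` yields the torsion relation.
  have hpow (k : ℕ) : k + 1 ≤ orderOf u →
      q (s (u ^ k)) = k • q (s u) ∧ q (s (u ^ (k + 1))) = (k + 1) • q (s u) := by
    induction k with
    | zero => simp [hs1]
    | succ k ih =>
      intro hk
      obtain ⟨h1, h2⟩ := ih (by omega)
      refine ⟨h2, ?_⟩
      have hne : u ^ (k + 1) ≠ 1 := pow_ne_one_of_lt_orderOf (by omega) (by omega)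
      have := hrel _ hne
      rw [← pow_succ', pow_succ' u k, inv_mul_cancel_left, ← pow_succ', h1, h2] at this
      rw [this, sub_eq_iff_eq_add, smul_smul, ← add_smul]
      congr 1
      ring
  have hpos : 0 < orderOf u := orderOf_pos u
  have hord : orderOf u • q (s u) = 0 := by
    have := (hpow (orderOf u - 1) (by omega)).2
    rw [Nat.sub_add_cancel hpos, pow_orderOf_eq_one, hs1, map_zero] at this
    exact this.symm
  have hk (x : A) : ∃ k : ℕ, u ^ k = x ∧ q (s x) = k • q (s u) := by
    obtain ⟨k, rfl⟩ := hu x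
    have hlt := Nat.mod_lt k hpos
    have := (hpow (k % orderOf u) (by omega)).1
    exact ⟨k % orderOf u, pow_mod_orderOf u k, by rwa [pow_mod_orderOf] at this⟩
  choose k hk1 hk2 using hk
  have hsum : f = ∑ x, f x • s x := by
    ext z
    simp [s, Finset.sum_apply, Subtype.coe_inj]
  have h1 : q f = (∑ x, f x * k x.1) • q (s u) := by
    conv_lhs => rw [hsum]
    rw [map_sum, Finset.sum_smul]
    refine Finset.sum_congr rfl fun x _ => ?_
    rw [map_smul, hk2, mul_smul, natCast_zsmul]
  have h2 : powProd A f = (∑ x, f x * k x.1) • Additive.ofMul u := by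
    rw [powProd, Fintype.linearCombination_apply, Finset.sum_smul]
    refine Finset.sum_congr rfl fun x _ => ?_
    rw [mul_smul, natCast_zsmul, ← ofMul_pow, hk1]
  rw [hf, ← ofMul_zpow, eq_comm, ofMul_eq_zero, ← orderOf_dvd_iff_zpow_eq_one] at h2
  obtain ⟨d, hd⟩ := h2
  rw [hd, mul_comm, mul_smul, natCast_zsmul, hord, smul_zero, Submodule.mkQ_apply,
    Submodule.Quotient.mk_eq_zero] at h1
  exact h1

end ShiftCartan

end McKay

/-! ### Sizes of conjugates of algebraic integers -/

namespace McKay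

section NumberField

variable {K : Type*} [Field K] [NumberField K]

/-- The sum of the absolute values of the conjugates of a nonzero algebraic integer is at least
their number. -/
theorem finrank_le_sum_norm_embeddings {x : K} (hx : IsIntegral ℤ x) (hx0 : x ≠ 0) :
    (Module.finrank ℚ K : ℝ) ≤ ∑ φ : K →+* ℂ, ‖φ x‖ := by
  -- The product is the absolute value of the norm, a nonzero rational integer. The sum is then
  -- bounded below through `log t ≤ t - 1`.
  have hprod : 1 ≤ ∏ φ : K →+* ℂ, ‖φ x‖ := by
    have h1 : ∏ φ : K →+* ℂ, ‖φ x‖ = |((Algebra.norm ℚ x : ℚ) : ℝ)| := by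
      rw [← norm_prod, Fintype.prod_equiv (RingHom.equivRatAlgHom K ℂ) (fun φ : K →+* ℂ => φ x)
        (fun φ : K →ₐ[ℚ] ℂ => φ x) fun _ => by simp,
        ← Algebra.norm_eq_prod_embeddings]
      simp
    obtain ⟨k, hk⟩ := IsIntegrallyClosed.isIntegral_iff.1 (Algebra.isIntegral_norm ℚ hx)
    have hk0 : k ≠ 0 := by
      rintro rfl
      rw [map_zero, eq_comm, Algebra.norm_eq_zero_iff] at hk
      exact hx0 hk
    rw [h1, ← hk]
    simpa using mod_cast Int.one_le_abs hk0
  have hpos (φ : K →+* ℂ) : 0 < ‖φ x‖ := norm_pos_iff.2 ((map_ne_zero φ).2 hx0)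
  have h1 : 0 ≤ ∑ φ : K →+* ℂ, (‖φ x‖ - 1) :=
    calc 0 ≤ Real.log (∏ φ : K →+* ℂ, ‖φ x‖) := Real.log_nonneg hprod
      _ = ∑ φ : K →+* ℂ, Real.log ‖φ x‖ := Real.log_prod fun φ _ => (hpos φ).ne'
      _ ≤ _ := Finset.sum_le_sum fun φ _ => Real.log_le_sub_one_of_pos (hpos φ)
  rw [Finset.sum_sub_distrib, Finset.sum_const, Finset.card_univ, NumberField.Embeddings.card,
    nsmul_one] at h1
  linarith

theorem norm_one_sub_sq {z : ℂ} (hz : ‖z‖ = 1) : ‖1 - z‖ ^ 2 = 2 * (1 - z).re := by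
  have h : Complex.normSq z = 1 := by rw [Complex.normSq_eq_norm_sq, hz, one_pow]
  rw [← Complex.normSq_eq_norm_sq, Complex.normSq_apply]
  rw [Complex.normSq_apply] at h
  simp only [Complex.sub_re, Complex.sub_im, Complex.one_re, Complex.one_im]
  linear_combination h

/-- Put `σ = ∑ (1 - z k)`. In each embedding `|1 - z|² = 2 Re (1 - z)`, so `∑ |f i| = 2 Re σ / |σ| ≤
2`. Summed over all embeddings, each nonzero integer `f i` contributes at least the degree. -/
theorem card_le_two_of_sum_one_sub_dvd {ι : Type*} {s : Finset ι} {z f : ι → K} {m : ℕ}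
    (hm : m ≠ 0) (hz : ∀ i ∈ s, z i ^ m = 1) (hz1 : ∀ i ∈ s, z i ≠ 1)
    (hf : ∀ i ∈ s, IsIntegral ℤ (f i))
    (h : ∀ i ∈ s, (∑ k ∈ s, (1 - z k)) * f i = (1 - z i) ^ 2) : s.card ≤ 2 := by
  rcases s.eq_empty_or_nonempty with rfl | ⟨i₀, hi₀⟩
  · simp
  have hne (i) (hi : i ∈ s) : (∑ k ∈ s, (1 - z k)) * f i ≠ 0 := by
    rw [h i hi]
    exact pow_ne_zero _ (sub_ne_zero.2 (hz1 i hi).symm)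
  have hφ (φ : K →+* ℂ) : ∑ i ∈ s, ‖φ (f i)‖ ≤ 2 := by
    have hx : 0 < ‖φ (∑ k ∈ s, (1 - z k))‖ :=
      norm_pos_iff.2 ((map_ne_zero φ).2 (left_ne_zero_of_mul (hne i₀ hi₀)))
    refine le_of_mul_le_mul_left ?_ hx
    calc _ = ∑ i ∈ s, ‖φ (∑ k ∈ s, (1 - z k)) * φ (f i)‖ := by
          simp only [norm_mul, Finset.mul_sum]
      _ = ∑ i ∈ s, 2 * (1 - φ (z i)).re := by
          refine Finset.sum_congr rfl fun i hi => ?_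
          rw [← map_mul, h i hi, map_pow, norm_pow, map_sub, map_one, norm_one_sub_sq]
          refine Complex.norm_eq_one_of_pow_eq_one ?_ hm
          rw [← map_pow, hz i hi, map_one]
      _ = 2 * (φ (∑ k ∈ s, (1 - z k))).re := by
          simp only [map_sum, map_sub, map_one, Complex.re_sum, Finset.mul_sum]
      _ ≤ _ := by
          rw [mul_comm]
          exact mul_le_mul_of_nonneg_right (Complex.re_le_norm _) two_pos.le
  have hd : (0 : ℝ) < Module.finrank ℚ K := Nat.cast_pos.2 Module.finrank_pos
  have : (s.card : ℝ) * Module.finrank ℚ K ≤ 2 * Module.finrank ℚ K :=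
    calc (s.card : ℝ) * Module.finrank ℚ K = ∑ i ∈ s, (Module.finrank ℚ K : ℝ) := by simp
      _ ≤ ∑ i ∈ s, ∑ φ : K →+* ℂ, ‖φ (f i)‖ := Finset.sum_le_sum fun i hi =>
          finrank_le_sum_norm_embeddings (hf i hi) (right_ne_zero_of_mul (hne i hi))
      _ = ∑ φ : K →+* ℂ, ∑ i ∈ s, ‖φ (f i)‖ := Finset.sum_comm
      _ ≤ ∑ φ : K →+* ℂ, 2 := Finset.sum_le_sum fun φ _ => hφ φ
      _ = 2 * Module.finrank ℚ K := by
          rw [Finset.sum_const, Finset.card_univ, NumberField.Embeddings.card, nsmul_eq_mul,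
            mul_comm]
  exact_mod_cast le_of_mul_le_mul_right this hd

end NumberField

/-- If `coker` is as small as possible, at most two of the `e (a i)` are nontrivial, for every
character `e`. -/
theorem card_filter_ne_one_le_two {A ι : Type*} [CommGroup A] [Fintype A] [DecidableEq A]
    [Fintype ι] (a : ι → A)
    (h : ∀ f, powProd A f = 0 → ∃ c, (shiftCartan a).transpose.mulVec c = f) (e : A →* ℂ) :
    (Finset.univ.filter fun i => e (a i) ≠ 1).card ≤ 2 := by
  have hpow (x : A) : e x ^ Fintype.card A = 1 := by rw [← map_pow, pow_card_eq_one, map_one]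
  have hint (x : A) : IsIntegral ℤ (e x) :=
    IsIntegral.of_pow Fintype.card_pos (by rw [hpow]; exact isIntegral_one)
  let K := IntermediateField.adjoin ℚ (Set.range e)
  have : FiniteDimensional ℚ K := IntermediateField.finiteDimensional_adjoin (by
    rintro _ ⟨x, rfl⟩
    exact (hint x).tower_top)
  have : NumberField K := { }
  let e' : A →* K :=
    { toFun x := ⟨e x, IntermediateField.subset_adjoin _ _ ⟨x, rfl⟩⟩
      map_one' := Subtype.ext (map_one e)
      map_mul' x y := Subtype.ext (map_mul e x y) }
  have he (x : A) : (e' x : ℂ) = e x := rfl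
  have hint' (x : A) : IsIntegral ℤ (e' x) :=
    (isIntegral_algebraMap_iff (algebraMap K ℂ).injective).1 (hint x)
  -- Taking `b = b' = a i` produces the squares `(1 - z i) ^ 2`.
  have hc (i : ι) := exists_sum_mul_eq_of_injective a h (a i) (a i)
  choose c hc using hc
  refine card_le_two_of_sum_one_sub_dvd (z := fun i => e' (a i))
    (f := fun i => ∑ x, (c i x : K) * e' x) (m := Fintype.card A) Fintype.card_ne_zero ?_ ?_ ?_ ?_
  · intro i _
    rw [← map_pow, pow_card_eq_one, map_one]
  · intro i hi h1
    exact (Finset.mem_filter.1 hi).2 (congrArg Subtype.val h1)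
  · intro i _
    exact IsIntegral.sum _ fun x _ => (isIntegral_algebraMap (x := c i x)).mul (hint' x)
  · intro i _
    have h1 := hc i e
    have h2 : ∑ k ∈ Finset.univ.filter (fun i => e (a i) ≠ 1), (1 - e (a k)) =
        ∑ k, (1 - e (a k)) := by
      refine Finset.sum_subset (Finset.subset_univ _) fun k _ hk => ?_
      have : e (a k) = 1 := by simpa using hk
      rw [this, sub_self]
    rw [← h2, ← sq] at h1
    apply Subtype.ext
    simpa [he] using h1

/-! ### Fourier coefficients and the bound on the dimension -/

section Characters

variable {G ι : Type*} [CommGroup G] [Fintype G] [Fintype (G →* ℂˣ)] [DecidableEq (G →* ℂˣ)]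

theorem sum_character_combination_mul (c : (G →* ℂˣ) → ℤ) (ψ : G →* ℂˣ) :
    ∑ g, (∑ φ, (c φ : ℂ) * φ g) * ψ g = Nat.card G * c ψ⁻¹ := by
  have h (φ : G →* ℂˣ) : ∑ g, (c φ : ℂ) * φ g * ψ g =
      if φ = ψ⁻¹ then Nat.card G * (c φ : ℂ) else 0 := by
    have h1 : φ * ψ = 1 ↔ φ = ψ⁻¹ := by
      rw [MonoidHom.ext_iff, MonoidHom.ext_iff]
      simp [mul_eq_one_iff_eq_inv]
    have := sum_monoidHom_units (φ * ψ)
    rw [if_congr h1 rfl rfl] at this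
    simp only [MonoidHom.mul_apply, Units.val_mul] at this
    simp only [mul_assoc, ← Finset.mul_sum, this]
    split_ifs <;> ring
  simp only [Finset.sum_mul]
  rw [Finset.sum_comm]
  simp only [h]
  simp

variable [Fintype ι]

/-- Each `g ≠ 1` moves exactly two eigenlines, by inverse scalars. Fourier integrality shows that
each index `i` has only one possible partner `j`; a third index would then give a product `g * h`
moving three eigenlines. -/
theorem card_le_two_of_injective (χ : ι → G →* ℂˣ) (hprod : ∏ i, χ i = 1)
    (hfaithful : ∀ g, (∀ i, χ i g = 1) → g = 1) (hne : ∀ i, χ i ≠ 1)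
    (hinj : ∀ f, powProd (G →* ℂˣ) f = 0 → ∃ c, (shiftCartan χ).transpose.mulVec c = f) :
    Fintype.card ι ≤ 2 := by
  classical
  have hthree (g : G) {i j k : ι} (hij : i ≠ j) (hik : i ≠ k) (hjk : j ≠ k) (hi : χ i g ≠ 1)
      (hj : χ j g ≠ 1) : χ k g = 1 := by
    by_contra hk
    have h1 := card_filter_ne_one_le_two χ hinj ((Units.coeHom ℂ).comp (MonoidHom.eval g))
    have h2 : ({i, j, k} : Finset ι) ⊆ Finset.univ.filter fun i =>
        ((Units.coeHom ℂ).comp (MonoidHom.eval g)) (χ i) ≠ 1 := by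
      intro l hl
      simp only [Finset.mem_insert, Finset.mem_singleton] at hl
      rcases hl with rfl | rfl | rfl <;> simpa
    have h3 := Finset.card_le_card h2
    rw [Finset.card_eq_three.2 ⟨i, j, k, hij, hik, hjk, rfl⟩] at h3
    omega
  have hprod' (g : G) : ∏ i, χ i g = 1 := by
    rw [← MonoidHom.finsetProd_apply, hprod, MonoidHom.one_apply]
  have hpair (g : G) (i : ι) (hi : χ i g ≠ 1) : ∃ j, i ≠ j ∧ χ j g ≠ 1 := by
    by_contra! hj
    have := hprod' g
    rw [Finset.prod_eq_single i (fun j _ hji => hj j hji.symm) (by simp)] at this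
    exact hi this
  have hsum (g : G) {i j : ι} (hij : i ≠ j) (hi : χ i g ≠ 1) (hj : χ j g ≠ 1) :
      ∑ k, (1 - (χ k g : ℂ)) = (1 - χ i g) * (1 - χ j g) := by
    have h1 : (χ i g : ℂ) * χ j g = 1 := by
      have := hprod' g
      rw [Fintype.prod_eq_mul i j hij fun k hk => hthree g hij hk.1.symm hk.2.symm hi hj] at this
      rw [← Units.val_mul, this, Units.val_one]
    rw [Fintype.sum_eq_add i j hij fun k hk => by
      rw [hthree g hij hk.1.symm hk.2.symm hi hj, Units.val_one, sub_self]]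
    linear_combination -h1
  have hval {g : G} {i : ι} (hi : χ i g ≠ 1) : (1 - (χ i g : ℂ)) ≠ 0 :=
    sub_ne_zero.2 fun h => hi (Units.ext h.symm)
  have hsum0 (g : G) (hg : g ≠ 1) : ∑ k, (1 - (χ k g : ℂ)) ≠ 0 := by
    obtain ⟨i, hi⟩ : ∃ i, χ i g ≠ 1 := by
      by_contra! h
      exact hg (hfaithful g h)
    obtain ⟨j, hij, hj⟩ := hpair g i hi
    rw [hsum g hij hi hj]
    exact mul_ne_zero (hval hi) (hval hj)
  let S (i j : ι) : Finset G := Finset.univ.filter fun g => χ i g ≠ 1 ∧ χ j g ≠ 1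
  have hnorm (i : ι) (g : G) : ‖1 - (χ i g : ℂ)‖ ^ 2 = -2 * ((χ i g : ℂ).re - 1) := by
    rw [norm_one_sub_sq, Complex.sub_re, Complex.one_re]
    · ring
    · refine Complex.norm_eq_one_of_pow_eq_one (n := Fintype.card G) ?_ Fintype.card_ne_zero
      rw [← Units.val_pow_eq_pow_val, ← map_pow, pow_card_eq_one, map_one, Units.val_one]
  have hre (i : ι) (g : G) : (χ i g : ℂ).re - 1 ≤ 0 := by
    linarith [hnorm i g, sq_nonneg ‖1 - (χ i g : ℂ)‖]
  have hre' (i : ι) (g : G) (hi : χ i g ≠ 1) : (χ i g : ℂ).re - 1 < 0 := by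
    linarith [hnorm i g, pow_pos (norm_pos_iff.2 (hval hi)) 2]
  -- For `g ≠ 1` the quotient of `(1 - χ i) (1 - χ j)` by `σ` is the indicator of `S i j`. Its
  -- unknown value at `g = 1` is killed by the factor `χ i g - 1`, so the sum is a difference of two
  -- Fourier coefficients.
  have hS {i j : ι} (hij : i ≠ j) : ∃ k : ℤ, ∑ g ∈ S i j, ((χ i g : ℂ) - 1) = Nat.card G * k := by
    obtain ⟨c, hc⟩ := exists_sum_mul_eq_of_injective χ hinj (χ i) (χ j)
    refine ⟨c (χ i)⁻¹ - c 1⁻¹, ?_⟩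
    have h1 := sum_character_combination_mul c (χ i)
    have h2 := sum_character_combination_mul c 1
    rw [Int.cast_sub, mul_sub, ← h1, ← h2, ← Finset.sum_sub_distrib, Finset.sum_filter]
    refine Finset.sum_congr rfl fun g _ => ?_
    rw [← mul_sub]
    rcases eq_or_ne g 1 with rfl | hg
    · simp
    have h3 := hc ((Units.coeHom ℂ).comp (MonoidHom.eval g))
    simp only [MonoidHom.comp_apply, Units.coeHom_apply, MonoidHom.eval_apply_apply] at h3
    split_ifs with h4
    · rw [← hsum g hij h4.1 h4.2, mul_eq_left₀ (hsum0 g hg)] at h3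
      simp [h3]
    · have h5 : (1 - (χ i g : ℂ)) * (1 - χ j g) = 0 := by
        rw [not_and_or, not_not, not_not] at h4
        rcases h4 with h4 | h4 <;> simp [h4]
      rw [h5] at h3
      rw [(mul_eq_zero.1 h3).resolve_left (hsum0 g hg), zero_mul]
  have hSre {i j : ι} (hij : i ≠ j) (hne : (S i j).Nonempty) :
      ∑ g ∈ S i j, ((χ i g : ℂ).re - 1) ≤ -Nat.card G := by
    obtain ⟨k, hk⟩ := hS hij
    have h1 : ∑ g ∈ S i j, ((χ i g : ℂ).re - 1) = Nat.card G * k := by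
      have := congrArg Complex.re hk
      rw [Complex.re_sum] at this
      simpa using this
    have h2 : ∑ g ∈ S i j, ((χ i g : ℂ).re - 1) < 0 :=
      Finset.sum_neg (fun g hg => hre' i g (Finset.mem_filter.1 hg).2.1) hne
    have hG : (0 : ℝ) < Nat.card G := Nat.cast_pos.2 Nat.card_pos
    rw [h1] at h2 ⊢
    have h3 : k ≤ -1 := by
      have : (k : ℝ) < 0 := by
        by_contra! h
        exact absurd h2 (not_lt.2 (mul_nonneg hG.le h))
      have : k < 0 := by exact_mod_cast this
      omega
    have h4 : (k : ℝ) ≤ -1 := by exact_mod_cast h3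
    nlinarith
  -- Two partners would contribute at most `-2 |G|` to `∑ g, (Re (χ i g) - 1)`, whose terms are
  -- nonpositive and whose total is `-|G|`.
  have hunique {i j k : ι} (hij : i ≠ j) (hik : i ≠ k) (hjk : j ≠ k) (h1 : (S i j).Nonempty)
      (h2 : (S i k).Nonempty) : False := by
    have hdisj : Disjoint (S i j) (S i k) := by
      rw [Finset.disjoint_left]
      intro g hg hg'
      have h3 := (Finset.mem_filter.1 hg).2
      exact (Finset.mem_filter.1 hg').2.2 (hthree g hij hik hjk h3.1 h3.2)
    have h3 : ∑ g, ((χ i g : ℂ).re - 1) ≤ ∑ g ∈ S i j ∪ S i k, ((χ i g : ℂ).re - 1) := by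
      rw [← Finset.sum_sdiff (Finset.subset_univ (S i j ∪ S i k))]
      exact add_le_of_nonpos_left (Finset.sum_nonpos fun g _ => hre i g)
    rw [Finset.sum_union hdisj] at h3
    have h4 : ∑ g, ((χ i g : ℂ).re - 1) = -Nat.card G := by
      have := congrArg Complex.re (sum_monoidHom_units (χ i))
      rw [if_neg (hne i), Complex.re_sum, Complex.zero_re] at this
      rw [Finset.sum_sub_distrib, this]
      simp
    have hG : (0 : ℝ) < Nat.card G := Nat.cast_pos.2 Nat.card_pos
    linarith [hSre hij h1, hSre hik h2]
  by_contra! hcard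
  obtain ⟨i⟩ : Nonempty ι := Fintype.card_pos_iff.1 (by omega)
  obtain ⟨g, hg⟩ : ∃ g, χ i g ≠ 1 := by
    by_contra! h
    exact hne i (MonoidHom.ext h)
  obtain ⟨j, hij, hj⟩ := hpair g i hg
  obtain ⟨k, hk⟩ : ∃ k, k ∉ ({i, j} : Finset ι) := by
    by_contra! h
    have := Finset.card_le_two (a := i) (b := j)
    rw [Finset.eq_univ_iff_forall.2 h, Finset.card_univ] at this
    omega
  simp only [Finset.mem_insert, Finset.mem_singleton, not_or] at hk
  obtain ⟨h, hh⟩ : ∃ h, χ k h ≠ 1 := by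
    by_contra! h
    exact hne k (MonoidHom.ext h)
  have hi : χ i h = 1 := by
    by_contra hi
    exact hunique hij (Ne.symm hk.1) (Ne.symm hk.2) ⟨g, by simp [S, hg, hj]⟩
      ⟨h, by simp [S, hi, hh]⟩
  have hj' : χ j h = 1 := by
    by_contra hj'
    exact hunique hij.symm (Ne.symm hk.2) (Ne.symm hk.1) ⟨g, by simp [S, hg, hj]⟩
      ⟨h, by simp [S, hj', hh]⟩
  -- On `g * h` both `χ i` and `χ j` keep their nontrivial values from `g`, forcing `χ k (g * h) =
  -- 1`, while `χ k g = 1` already.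
  refine hh ?_
  have h1 := hthree (g * h) hij (Ne.symm hk.1) (Ne.symm hk.2) (by simpa [hi]) (by simpa [hj'])
  rwa [map_mul, hthree g hij (Ne.symm hk.1) (Ne.symm hk.2) hg hj, one_mul] at h1

end Characters

end McKay

/-! ### From the critical group to the shift matrix -/

namespace McKay

section Diagonalization

variable {G : Type*} [CommGroup G] [Finite G]

theorem nonempty_criticalGroup_equiv {V ι : Type*} [AddCommGroup V] [Module ℂ V] [Fintype ι]
    (γ : Representation ℂ G V) (b : Module.Basis ι ℂ V) (χ : ι → G →* ℂˣ)
    (hb : ∀ g i, γ g (b i) = (χ i g : ℂ) • b i) [Fintype (G →* ℂˣ)] [DecidableEq (G →* ℂˣ)] :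
    Nonempty (criticalGroup γ ≃+ cokerTranspose (shiftCartan χ)) := by
  have h : (mckayCartan γ).submatrix nontrivialLinearCharEquiv nontrivialLinearCharEquiv =
      shiftCartan χ := by
    ext φ ψ
    have h1 : (linearCharEquiv φ.1 = linearCharEquiv ψ.1) = (φ = ψ) := by
      rw [linearCharEquiv.injective.eq_iff, Subtype.coe_inj]
    have h2 := mckayMatrix_linearCharEquiv γ b χ hb φ.1 ψ.1
    change ((Module.finrank ℂ V : ℤ) • (1 : Matrix (IrrChar G) (IrrChar G) ℤ))
      (linearCharEquiv φ.1) (linearCharEquiv ψ.1) -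
      mckayMatrix γ (linearCharEquiv φ.1) (linearCharEquiv ψ.1) = _
    rw [h2, Matrix.smul_apply, Matrix.one_apply, shiftCartan, Matrix.of_apply,
      Module.finrank_eq_card_basis b, smul_eq_mul]
    congr 2
    simp only [h1]
  obtain ⟨e⟩ := nonempty_cokerTranspose_submatrix_equiv nontrivialLinearCharEquiv (mckayCartan γ)
  rw [h] at e
  exact ⟨e.symm⟩

variable {n : ℕ} (γ : G →* SL(n, ℂ))

theorem exists_eigenbasis_slRep :
    ∃ (b : Module.Basis (Fin n) ℂ (Fin n → ℂ)) (χ : Fin n → G →* ℂˣ),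
      (∀ g i, slRep γ g (b i) = (χ i g : ℂ) • b i) ∧ ∏ i, χ i = 1 := by
  obtain ⟨b, χ, hb⟩ := exists_eigenbasis (slRep γ)
  let e : Fin (Module.finrank ℂ (Fin n → ℂ)) ≃ Fin n := finCongr (Module.finrank_fin_fun ℂ)
  let b' := b.reindex e
  have hb' (g : G) (i : Fin n) : slRep γ g (b' i) = (χ (e.symm i) g : ℂ) • b' i := by
    simp [b', hb]
  refine ⟨b', fun i => χ (e.symm i), hb', MonoidHom.ext fun g => Units.ext ?_⟩
  have h1 : LinearMap.det (slRep γ g) = 1 := by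
    change LinearMap.det (Matrix.toLin' (γ g : Matrix (Fin n) (Fin n) ℂ)) = 1
    rw [LinearMap.det_toLin', (γ g).det_coe]
  have h2 : LinearMap.toMatrix b' b' (slRep γ g) =
      Matrix.diagonal fun i => (χ (e.symm i) g : ℂ) := by
    ext i j
    rw [LinearMap.toMatrix_apply, hb', map_smul, Finsupp.smul_apply, b'.repr_self,
      Finsupp.single_apply, Matrix.diagonal_apply]
    rcases eq_or_ne i j with rfl | h
    · simp
    · simp [h, h.symm]
  rw [← LinearMap.det_toMatrix b', h2, Matrix.det_diagonal] at h1
  simpa [MonoidHom.finsetProd_apply] using h1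

end Diagonalization

/-- A faithful sum of two linear characters of determinant one is the sum of a faithful character
and its inverse. -/
theorem eq_pair_of_faithful {G : Type*} [CommGroup G] {χ : Fin 2 → G →* ℂˣ} (hprod : ∏ i, χ i = 1)
    (hfaithful : ∀ g, (∀ i, χ i g = 1) → g = 1) :
    ∃ u : G →* ℂˣ, Function.Injective u ∧ ![u, u⁻¹] = χ := by
  have h1 : (χ 0)⁻¹ = χ 1 := by
    rw [Fin.prod_univ_two] at hprod
    ext g
    rw [MonoidHom.inv_apply, eq_inv_of_mul_eq_one_right (DFunLike.congr_fun hprod g)]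
  refine ⟨χ 0, (injective_iff_map_eq_one _).2 fun g hg => hfaithful g fun i => ?_, ?_⟩
  · fin_cases i
    · exact hg
    · simpa [← h1] using hg
  · ext i : 1
    fin_cases i
    · rfl
    · exact h1

/-! ### Faithful linear characters and cyclic groups -/

section Faithful

variable {G : Type*} [CommGroup G] [Finite G] {u : G →* ℂˣ}

theorem isCyclic_of_injective_linearChar (hu : Function.Injective u) : IsCyclic G :=
  isCyclic_of_injective_ringHom ((Units.coeHom ℂ).comp u)
    (Units.val_injective.comp hu)

theorem exists_pow_apply_eq (hu : Function.Injective u) {g : G} {z : ℂ} (hz : z ^ orderOf g = 1) :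
    ∃ k : ℕ, ((u (g ^ k) : ℂˣ) : ℂ) = z := by
  have h : IsPrimitiveRoot (u g : ℂ) (orderOf g) := by
    rw [← orderOf_injective u hu, IsPrimitiveRoot.coe_units_iff]
    exact IsPrimitiveRoot.orderOf _
  have : NeZero (orderOf g) := ⟨(orderOf_pos g).ne'⟩
  obtain ⟨k, -, hk⟩ := h.eq_pow_of_pow_eq_one hz
  exact ⟨k, by rw [map_pow, Units.val_pow_eq_pow_val, hk]⟩

/-- A faithful linear character generates the character group. -/
theorem mem_powers_of_injective (hu : Function.Injective u) (φ : G →* ℂˣ) :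
    φ ∈ Submonoid.powers u := by
  have := isCyclic_of_injective_linearChar hu
  obtain ⟨g, hg⟩ := IsCyclic.exists_generator (α := G)
  obtain ⟨k, hk⟩ := exists_pow_apply_eq hu (g := g) (z := φ g) (by
    rw [← Units.val_pow_eq_pow_val, ← map_pow, pow_orderOf_eq_one, map_one, Units.val_one])
  refine ⟨k, MonoidHom.ext fun x => ?_⟩
  obtain ⟨l, rfl⟩ := hg x
  have : u g ^ k = φ g := by rw [← map_pow]; exact Units.ext hk
  simp only [MonoidHom.pow_apply, map_zpow, ← this]

theorem exists_zmod_equiv_apply_eq_exp (hu : Function.Injective u) :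
    ∃ φ : Multiplicative (ZMod (Nat.card G)) ≃* G, (u (φ (Multiplicative.ofAdd 1)) : ℂ) =
      Complex.exp (2 * Real.pi * Complex.I / Nat.card G) := by
  have := isCyclic_of_injective_linearChar hu
  obtain ⟨g, hg⟩ := IsCyclic.exists_generator (α := G)
  have hω := Complex.isPrimitiveRoot_exp (Nat.card G) Nat.card_pos.ne'
  -- The generator must be adjusted to a power whose image under `u` is exactly `exp (2πi / |G|)`;
  -- injectivity makes that power a generator again.
  obtain ⟨k, hk⟩ := exists_pow_apply_eq hu (g := g) (z := _) (by
    rw [orderOf_eq_card_of_forall_mem_zpowers hg]; exact hω.pow_eq_one)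
  rw [← hk, IsPrimitiveRoot.coe_units_iff] at hω
  have hord : orderOf (g ^ k) = Nat.card G := by
    rw [← orderOf_injective u hu, hω.eq_orderOf]
  have hgen (x : G) : x ∈ Subgroup.zpowers (g ^ k) := by
    have : Subgroup.zpowers (g ^ k) = ⊤ :=
      Subgroup.eq_top_of_card_eq _ (by rw [Nat.card_zpowers, hord])
    rw [this]
    trivial
  refine ⟨zmodMulEquivOfGenerator hgen rfl, ?_⟩
  rw [zmodMulEquivOfGenerator_apply_ofAdd_one, hk]

end Faithful

end McKay

/-- Let `G` be a finite abelian group and `γ : G → SL_n(ℂ)` (`n ≥ 1`) a faithful representation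
without trivial summand. Then `K(γ)` is isomorphic to the character group of `G` if and only if
`n = 2`, and this is so if and only if `G` is cyclic and `γ` is McKay's representation of type
`A_{m-1}`. -/
theorem mainTheorem6 {G : Type*} [CommGroup G] [Finite G] (n : ℕ) (hn : 1 ≤ n)
    (γ : G →* Matrix.SpecialLinearGroup (Fin n) ℂ)
    (hfaithful : Function.Injective γ)
    (hnotriv : ∀ v : Fin n → ℂ, (∀ g : G, McKay.slRep γ g v = v) → v = 0) :
    (Nonempty (McKay.criticalGroup (McKay.slRep γ) ≃+ Additive (G →* ℂˣ)) ↔ n = 2) ∧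
    (n = 2 ↔ McKay.IsMcKayTypeA γ) := by
  classical
  have := Fintype.ofFinite G
  have := Fintype.ofFinite (G →* ℂˣ)
  obtain ⟨b, χ, hb, hprod⟩ := McKay.exists_eigenbasis_slRep γ
  have hker (g : G) (hg : ∀ i, χ i g = 1) : g = 1 := by
    refine hfaithful ?_
    rw [map_one]
    have h1 : Matrix.toLin' (γ g : Matrix (Fin n) (Fin n) ℂ) = Matrix.toLin' 1 :=
      b.ext fun i => (hb g i).trans (by simp [hg])
    exact Subtype.ext (Matrix.toLin'.injective h1)
  have hne (i : Fin n) : χ i ≠ 1 := by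
    intro h
    exact b.ne_zero i (hnotriv _ fun g => by rw [hb, h]; simp)
  refine ⟨?_, ?_, ?_⟩
  · obtain ⟨e⟩ := McKay.nonempty_criticalGroup_equiv (McKay.slRep γ) b χ hb
    have h1 : Nonempty (McKay.criticalGroup (McKay.slRep γ) ≃+ Additive (G →* ℂˣ)) ↔
        Nonempty (McKay.cokerTranspose (McKay.shiftCartan χ) ≃+ Additive (G →* ℂˣ)) :=
      ⟨fun ⟨f⟩ => ⟨e.symm.trans f⟩, fun ⟨f⟩ => ⟨e.trans f⟩⟩
    rw [h1, McKay.nonempty_cokerTranspose_shiftCartan_equiv_iff χ hprod]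
    constructor
    · intro hinj
      have h2 := McKay.card_le_two_of_injective χ hprod hker hne hinj
      rw [Fintype.card_fin] at h2
      have h3 : n ≠ 1 := by
        rintro rfl
        rw [Fin.prod_univ_one] at hprod
        exact hne 0 hprod
      omega
    · rintro rfl f hf
      obtain ⟨u, hu, rfl⟩ := McKay.eq_pair_of_faithful hprod hker
      exact McKay.exists_transpose_shiftCartan_mulVec_eq u (McKay.mem_powers_of_injective hu) hf
  · rintro rfl
    obtain ⟨u, hu, rfl⟩ := McKay.eq_pair_of_faithful hprod hker
    obtain ⟨φ, hφ⟩ := McKay.exists_zmod_equiv_apply_eq_exp hu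
    refine ⟨Nat.card G, φ, b, ?_, ?_⟩
    -- A trivial group has only the trivial character, which is excluded.
    · by_contra! h
      have hG : Subsingleton G := Finite.card_le_one_iff_subsingleton.1 (by omega)
      exact hne 0 (MonoidHom.ext fun g => by rw [Subsingleton.elim g 1, map_one, map_one])
    · ext i j
      rw [LinearMap.toMatrix_apply, hb, map_smul, Finsupp.smul_apply, b.repr_self,
        Finsupp.single_apply, ← hφ]
      fin_cases i <;> fin_cases j <;> simp
  · rintro ⟨m, φ, b', -, -⟩
    have := Module.finrank_eq_card_basis b'
    simpa using this
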